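/- An overpartition of a nonnegative integer $n$ is a partition of $n$ in which the first occurrence of each number may be overlined (there is exactly one overpartition of $0$). An overpartition pair of $n$ is an ordered pair of overpartitions $(\lambda,\mu)$ (either of which may be the overpartition of $0$) such that the sum of all parts of $\lambda$ and $\mu$ is $n$. Let $\overline{pp}(n)$ denote the number of overpartition pairs of $n$, and for $|q|<1$ write $(a;q)_\infty=\prod_{k=1}^\infty(1-aq^{k-1})$. Then for every complex number $q$ with $|q|<1$ the following series converge absolutely and \[ \sum_{n=0}^\infty \overline{pp}(3n+2)\,q^n = 12\,\frac{(q^2;q^2)_\infty^6\,(q^3;q^3)_\infty^6}{(q;q)_\infty^{14}}, \qquad \sum_{n=0}^\infty \overline{pp}(4n+3)\,q^n = 32\,\frac{(q^2;q^2)_\infty^{20}}{(q;q)_\infty^{22}}. \] -/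

import Mathlib

/-- An overpartition of `n`: a partition of `n` in which the first occurrence of each number may
be overlined. It is given by the underlying partition together with the set of those part sizes
whose first occurrence is overlined. -/
@[ext]
structure Overpartition (n : ℕ) where
  /-- the underlying partition of `n` -/
  toPartition : n.Partition
  /-- the part sizes whose first occurrence is overlined -/
  overlined : Finset ℕ
  /-- only numbers that occur as parts can be overlined -/
  overlined_subset : overlined ⊆ toPartition.parts.toFinset

instance Overpartition.instFinite (n : ℕ) : Finite (Overpartition n) := by
  refine Finite.of_injective
    (fun o : Overpartition n =>
      (⟨o.toPartition, o.overlined, Finset.mem_powerset.2 o.overlined_subset⟩ :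
        Σ p : n.Partition, {s : Finset ℕ // s ∈ p.parts.toFinset.powerset})) ?_
  rintro ⟨p, s, hs⟩ ⟨p', s', hs'⟩ h
  simp only [Sigma.mk.injEq] at h
  obtain ⟨rfl, h⟩ := h
  simpa using h

/-- An overpartition pair of `n`: a pair of overpartitions `(lam, mu)`, of `i` and of `j` say (either
may be zero), such that the sum of all of the parts is `i + j = n`. -/
abbrev OverpartitionPair (n : ℕ) : Type :=
  Σ ij : {ij : ℕ × ℕ // ij ∈ Finset.HasAntidiagonal.antidiagonal n},
    Overpartition ij.1.1 × Overpartition ij.1.2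

/-- The number of overpartition pairs of `n`. -/
noncomputable def overpartitionPairCount (n : ℕ) : ℕ :=
  Nat.card (OverpartitionPair n)

theorem finite_overpartitionPair (n : ℕ) : Finite (OverpartitionPair n) := inferInstance

/-- The `q`-shifted factorial `(a; q)_∞ = ∏_{k ≥ 1} (1 - a q^(k-1))`, used for `|q| < 1`. -/
noncomputable def qPochhammerInf (a q : ℂ) : ℂ :=
  ∏' k : ℕ, (1 - a * q ^ k)

/-- The product defining `(a; q)_∞` converges for `|q| < 1`. -/
theorem multipliable_qPochhammerInf (a q : ℂ) (hq : ‖q‖ < 1) :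
    Multipliable (fun k : ℕ => 1 - a * q ^ k) := by
  have h : Summable (fun k : ℕ => ‖-(a * q ^ k)‖) := by
    simp only [norm_neg, norm_mul, norm_pow]
    exact (summable_geometric_of_lt_one (norm_nonneg q) hq).mul_left _
  simpa only [sub_eq_add_neg] using multipliable_one_add_of_summable h

/-!
The generating function of overpartitions is `∏ (1 + q ^ k) / (1 - q ^ k)`: the formal expansion
is that of `Nat.Partition.genFun` with the weight `2` for every part size that occurs, and it
converges for `|q| < 1` by comparison with the finite products (`tsum_card_overpartition`). So
overpartition pairs have the generating function `1 / φ(-q) ^ 2`, where `φ(q) = ∑ q ^ (n ^ 2)` and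
`φ(-q) = (q; q)_∞ ^ 2 / (q²; q²)_∞` by Jacobi's triple product (`hasSum_tripleProduct`). The
latter is the limit of its finite form, whose coefficients are Gaussian binomial coefficients.

*Index `2` modulo `3`.* Sorting the squares modulo `3` gives `φ(-q) = a - 2 * b` with `a = φ(-q⁹)`
and `b = q * Ω(q³)`, where the triple product evaluates `Ω` (`ramanujanPhi_neg_eq_three`). For a
primitive cube root of unity `w`, the rotation of `q` by `w` fixes `a` and multiplies `b` by `w`,
and `∏ φ(-w ^ i * q) = φ(-q³) ^ 4 / φ(-q⁹)` because `φ` is a product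
(`ramanujanPhi_neg_mul_cubeRoots`). Over the common denominator `φ(-q³) ^ 8`, the wanted part of
`1 / (a - 2 * b) ^ 2` has the numerator `12 * a ^ 4 * b ^ 2` (`sum_cubeRoots_one_div_sq`).

*Index `3` modulo `4`.* From the products, `φ(q) * φ(-q) = φ(-q²) ^ 2`, so that
`1 / φ(-q) ^ 2 = φ(q) ^ 2 * φ(q²) ^ 4 / φ(-q⁴) ^ 8`. Since `φ(q) ^ 2 = φ(q²) ^ 2 + 4 * q * ψ(q⁴) ^ 2`
(`ramanujanPhi_sq`), the odd part can be read off, and once more after replacing `q²` by `q`;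
`φ(q) * ψ(q²) = ψ(q) ^ 2` simplifies the result.

The subseries are extracted by averaging over roots of unity at a root of `q`, which needs
`q ≠ 0`; at the origin both sides agree by continuity (`hasSum_of_hasSum_ne_zero`).
-/

open Filter Topology Finset

/-! ### Infinite products -/

lemma norm_mul_pow_lt_one {a q : ℂ} (ha : ‖a‖ < 1) (hq : ‖q‖ < 1) (k : ℕ) : ‖a * q ^ k‖ < 1 := by
  rw [norm_mul, norm_pow]
  calc ‖a‖ * ‖q‖ ^ k ≤ ‖a‖ * 1 := by
        gcongr
        exact pow_le_one₀ (norm_nonneg _) hq.le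
    _ < 1 := by simpa using ha

lemma norm_pow_lt_one {q : ℂ} (hq : ‖q‖ < 1) {m : ℕ} (hm : m ≠ 0) : ‖q ^ m‖ < 1 := by
  rw [norm_pow]
  exact pow_lt_one₀ (norm_nonneg _) hq hm

lemma one_sub_mul_pow_ne_zero {a q : ℂ} (ha : ‖a‖ < 1) (hq : ‖q‖ < 1) (k : ℕ) :
    1 - a * q ^ k ≠ 0 := by
  intro h
  have h1 : a * q ^ k = 1 := by linear_combination -h
  have h2 := norm_mul_pow_lt_one ha hq k
  simp [h1] at h2

lemma cubeRoot_pow_three {w : ℂ} (hw : w ^ 2 + w + 1 = 0) : w ^ 3 = 1 := by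
  linear_combination (w - 1) * hw

lemma norm_cubeRoot {w : ℂ} (hw : w ^ 2 + w + 1 = 0) : ‖w‖ = 1 := by
  rw [← pow_eq_one_iff_of_nonneg (norm_nonneg w) three_ne_zero, ← norm_pow,
    cubeRoot_pow_three hw, norm_one]

lemma qPochhammerInf_ne_zero {a q : ℂ} (ha : ‖a‖ < 1) (hq : ‖q‖ < 1) :
    qPochhammerInf a q ≠ 0 := by
  have := tprod_one_add_ne_zero_of_summable (f := fun k : ℕ => -(a * q ^ k)) (fun k => by
      simpa only [← sub_eq_add_neg] using one_sub_mul_pow_ne_zero ha hq k) (by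
      simp only [norm_neg, norm_mul, norm_pow]
      exact (summable_geometric_of_lt_one (norm_nonneg q) hq).mul_left _)
  simpa only [qPochhammerInf, ← sub_eq_add_neg] using this

lemma qPochhammerInf_self_ne_zero {q : ℂ} (hq : ‖q‖ < 1) : qPochhammerInf q q ≠ 0 :=
  qPochhammerInf_ne_zero hq hq

lemma qPochhammerInf_eq_mul_succ (a : ℂ) {q : ℂ} (hq : ‖q‖ < 1) :
    qPochhammerInf a q = (1 - a) * qPochhammerInf (a * q) q := by
  have h := multipliable_qPochhammerInf (a * q) q hq
  have h' : Multipliable fun k : ℕ => 1 - a * q ^ (k + 1) := by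
    simpa only [pow_succ', mul_assoc] using h
  have h0 := tprod_eq_zero_mul' (f := fun k : ℕ => 1 - a * q ^ k) h'
  simpa only [qPochhammerInf, pow_succ', mul_assoc, pow_zero, mul_one] using h0

/-- Splitting a `q`-shifted factorial according to the parity of the exponent. -/
lemma qPochhammerInf_split_two (a : ℂ) {q : ℂ} (hq : ‖q‖ < 1) :
    qPochhammerInf a q = qPochhammerInf a (q ^ 2) * qPochhammerInf (a * q) (q ^ 2) := by
  have hq2 := norm_pow_lt_one hq two_ne_zero
  have h0 := multipliable_qPochhammerInf a (q ^ 2) hq2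
  have h1 := multipliable_qPochhammerInf (a * q) (q ^ 2) hq2
  simp only [qPochhammerInf]
  rw [← tprod_even_mul_odd (f := fun k : ℕ => 1 - a * q ^ k)]
  · simp only [pow_succ', mul_assoc, pow_mul, pow_zero, mul_one]
  · simpa only [pow_mul] using h0
  · simpa only [pow_succ', mul_assoc, pow_mul, pow_zero, mul_one] using h1

/-- Splitting a `q`-shifted factorial according to the residue of the exponent modulo `3`. -/
lemma qPochhammerInf_split_three (a : ℂ) {q : ℂ} (hq : ‖q‖ < 1) :
    qPochhammerInf a q = qPochhammerInf a (q ^ 3) * qPochhammerInf (a * q) (q ^ 3) *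
      qPochhammerInf (a * q ^ 2) (q ^ 3) := by
  have hq3 := norm_pow_lt_one hq three_ne_zero
  have h0 := (multipliable_qPochhammerInf a (q ^ 3) hq3).tendsto_prod_tprod_nat
  have h1 := (multipliable_qPochhammerInf (a * q) (q ^ 3) hq3).tendsto_prod_tprod_nat
  have h2 := (multipliable_qPochhammerInf (a * q ^ 2) (q ^ 3) hq3).tendsto_prod_tprod_nat
  have h := (multipliable_qPochhammerInf a q hq).tendsto_prod_tprod_nat
  have h' := h.comp (tendsto_id.const_mul_atTop' (r := 3) (by norm_num))
  refine tendsto_nhds_unique h' (((h0.mul h1).mul h2).congr fun n => ?_)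
  simp only [Function.comp_apply, id]
  induction n with
  | zero => simp
  | succ n ih =>
    rw [Nat.mul_succ]
    simp only [prod_range_succ, ← ih]
    ring

lemma qPochhammerInf_mul_neg (a : ℂ) {q : ℂ} (hq : ‖q‖ < 1) :
    qPochhammerInf a q * qPochhammerInf (-a) q = qPochhammerInf (a ^ 2) (q ^ 2) := by
  simp only [qPochhammerInf]
  rw [← (multipliable_qPochhammerInf a q hq).tprod_mul (multipliable_qPochhammerInf (-a) q hq)]
  exact tprod_congr fun k => by ring

/-- The product over the three cube roots of unity `1, w, w²`. -/
lemma qPochhammerInf_mul_cubeRoots (a : ℂ) {q w : ℂ} (hq : ‖q‖ < 1) (hw : w ^ 2 + w + 1 = 0) :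
    qPochhammerInf a q * qPochhammerInf (w * a) q * qPochhammerInf (w ^ 2 * a) q =
      qPochhammerInf (a ^ 3) (q ^ 3) := by
  have h0 := multipliable_qPochhammerInf a q hq
  have h1 := multipliable_qPochhammerInf (w * a) q hq
  have h2 := multipliable_qPochhammerInf (w ^ 2 * a) q hq
  simp only [qPochhammerInf]
  rw [← h0.tprod_mul h1, ← (h0.mul h1).tprod_mul h2]
  refine tprod_congr fun k => ?_
  rw [← pow_mul, mul_comm 3 k, pow_mul]
  generalize q ^ k = x
  linear_combination (-a * x + w * a ^ 2 * x ^ 2 - (w - 1) * a ^ 3 * x ^ 3) * hw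

lemma continuousAt_qPochhammerInf_self_zero :
    ContinuousAt (fun q : ℂ => qPochhammerInf q q) 0 := by
  have h := ModularForm.differentiableOn_tprod_one_sub_pow.continuousOn.continuousAt
    (Metric.ball_mem_nhds (0 : ℂ) one_pos)
  simpa only [qPochhammerInf, pow_succ'] using h

lemma continuousAt_qPochhammerInf_pow_zero {m : ℕ} (hm : m ≠ 0) :
    ContinuousAt (fun q : ℂ => qPochhammerInf (q ^ m) (q ^ m)) 0 := by
  have h : ContinuousAt (fun q : ℂ => qPochhammerInf q q) ((0 : ℂ) ^ m) := by
    simpa [hm] using continuousAt_qPochhammerInf_self_zero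
  exact h.comp (f := fun q : ℂ => q ^ m) (continuous_pow m).continuousAt

lemma qPochhammerInf_self_mul_neg {q : ℂ} (hq : ‖q‖ < 1) :
    qPochhammerInf q q * qPochhammerInf (-q) q = qPochhammerInf (q ^ 2) (q ^ 2) :=
  qPochhammerInf_mul_neg q hq

/-- `(-q; -q)_∞` in terms of `(q^m; q^m)_∞` for `m = 1, 2, 4`. -/
lemma qPochhammerInf_neg_self {q : ℂ} (hq : ‖q‖ < 1) :
    qPochhammerInf (-q) (-q) * (qPochhammerInf q q * qPochhammerInf (q ^ 4) (q ^ 4)) =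
      qPochhammerInf (q ^ 2) (q ^ 2) ^ 3 := by
  have hq2 := norm_pow_lt_one hq two_ne_zero
  have h1 := qPochhammerInf_split_two (-q) (q := -q) (by simpa using hq)
  have h2 := qPochhammerInf_split_two q hq
  have h3 := qPochhammerInf_mul_neg q hq2
  have h4 := qPochhammerInf_split_two (q ^ 2) hq2
  simp only [neg_sq, ← sq, ← pow_mul] at h1 h2 h3 h4
  norm_num at h1 h2 h3 h4
  rw [h1, h2]
  linear_combination (qPochhammerInf (q ^ 2) (q ^ 2) ^ 2 * qPochhammerInf (q ^ 4) (q ^ 4)) * h3 -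
    qPochhammerInf (q ^ 2) (q ^ 2) ^ 2 * h4

/-- The product of `(q; q)_∞` over the three rotations of `q` by cube roots of unity. -/
lemma qPochhammerInf_self_mul_cubeRoots {q w : ℂ} (hq : ‖q‖ < 1) (hw : w ^ 2 + w + 1 = 0) :
    qPochhammerInf q q * qPochhammerInf (w * q) (w * q) *
      qPochhammerInf (w ^ 2 * q) (w ^ 2 * q) * qPochhammerInf (q ^ 9) (q ^ 9) =
      qPochhammerInf (q ^ 3) (q ^ 3) ^ 4 := by
  have hw3 := cubeRoot_pow_three hw
  have hwn := norm_cubeRoot hw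
  have hq3 := norm_pow_lt_one hq three_ne_zero
  -- Modulo `3`, the third factor of each splitting is `(q³; q³)_∞`; the first and the second ones
  -- multiply to `(q³; q⁹)_∞` and `(q⁶; q⁹)_∞` over the three rotations.
  have h0 := qPochhammerInf_split_three q hq
  have h1 := qPochhammerInf_split_three (w * q) (q := w * q) (by simpa [hwn] using hq)
  have h2 := qPochhammerInf_split_three (w ^ 2 * q) (q := w ^ 2 * q) (by simpa [hwn] using hq)
  have h3 := qPochhammerInf_split_three (q ^ 3) hq3
  have hc1 := qPochhammerInf_mul_cubeRoots q hq3 hw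
  have hc2 := qPochhammerInf_mul_cubeRoots (q ^ 2) hq3 hw
  rw [show q * q = q ^ 2 by ring, show q * q ^ 2 = q ^ 3 by ring] at h0
  rw [show (w * q) ^ 3 = q ^ 3 by rw [mul_pow, hw3, one_mul],
    show w * q * (w * q) = w ^ 2 * q ^ 2 by ring,
    show w * q * (w * q) ^ 2 = q ^ 3 by linear_combination q ^ 3 * hw3] at h1
  rw [show (w ^ 2 * q) ^ 3 = q ^ 3 by linear_combination (w ^ 3 + 1) * q ^ 3 * hw3,
    show w ^ 2 * q * (w ^ 2 * q) = w * q ^ 2 by linear_combination w * q ^ 2 * hw3,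
    show w ^ 2 * q * (w ^ 2 * q) ^ 2 = q ^ 3 by linear_combination (w ^ 3 + 1) * q ^ 3 * hw3] at h2
  simp only [← pow_mul, ← pow_add] at h3 hc1 hc2
  norm_num at h3 hc1 hc2
  rw [h0, h1, h2]
  calc _ = (qPochhammerInf q (q ^ 3) * qPochhammerInf (w * q) (q ^ 3) *
        qPochhammerInf (w ^ 2 * q) (q ^ 3)) * (qPochhammerInf (q ^ 2) (q ^ 3) *
        qPochhammerInf (w * q ^ 2) (q ^ 3) * qPochhammerInf (w ^ 2 * q ^ 2) (q ^ 3)) *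
        qPochhammerInf (q ^ 9) (q ^ 9) * qPochhammerInf (q ^ 3) (q ^ 3) ^ 3 := by ring
    _ = _ := by rw [hc1, hc2, ← h3]; ring

/-- `(q; q⁶)_∞ (q⁵; q⁶)_∞` in terms of `(q^m; q^m)_∞` for `m = 1, 2, 3, 6`. -/
lemma qPochhammerInf_one_mul_five {q : ℂ} (hq : ‖q‖ < 1) :
    qPochhammerInf q (q ^ 6) * qPochhammerInf (q ^ 5) (q ^ 6) *
      (qPochhammerInf (q ^ 2) (q ^ 2) * qPochhammerInf (q ^ 3) (q ^ 3)) =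
      qPochhammerInf q q * qPochhammerInf (q ^ 6) (q ^ 6) := by
  have h1 := qPochhammerInf_split_two q hq
  have h2 := qPochhammerInf_split_two (q ^ 3) (norm_pow_lt_one hq three_ne_zero)
  have h3 := qPochhammerInf_split_three q (norm_pow_lt_one hq two_ne_zero)
  simp only [← pow_mul, ← pow_succ', ← sq] at h1 h2 h3
  norm_num at h1 h2 h3
  rw [h1, h2, h3]
  ring

/-! ### The Jacobi triple product -/

/-- The finite `q`-shifted factorial `(Q; Q)_n`. -/
noncomputable def qFactorial (Q : ℂ) (n : ℕ) : ℂ := ∏ k ∈ range n, (1 - Q * Q ^ k)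

/-- The reciprocal `1 / (Q; Q)_m`, extended by `0` to negative `m`: with this convention the
recurrence `qFactorialInv_eq` holds for every integer `m`. -/
noncomputable def qFactorialInv (Q : ℂ) (m : ℤ) : ℂ :=
  if m < 0 then 0 else (qFactorial Q m.toNat)⁻¹

lemma qFactorialInv_eq {Q : ℂ} (hQ : ‖Q‖ < 1) (m : ℤ) :
    qFactorialInv Q m = (1 - Q ^ (m + 1)) * qFactorialInv Q (m + 1) := by
  rcases lt_trichotomy m (-1) with hm | rfl | hm
  · simp [qFactorialInv, show m < 0 by omega, show m + 1 < 0 by omega]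
  · simp [qFactorialInv]
  · lift m to ℕ using by omega
    have h := one_sub_mul_pow_ne_zero hQ hQ m
    have h' : ¬ ((m : ℤ) + 1 < 0) := by omega
    have hz : Q ^ ((m : ℤ) + 1) = Q * Q ^ m := by
      rw [show ((m : ℤ) + 1) = ((m + 1 : ℕ) : ℤ) by push_cast; rfl, zpow_natCast, pow_succ']
    have ht : ((m : ℤ) + 1).toNat = m + 1 := by omega
    simp only [qFactorialInv, h', ht, hz, qFactorial, prod_range_succ, mul_inv]
    simp [mul_comm _ (1 - Q * Q ^ m)⁻¹, mul_inv_cancel_left₀ h]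

/-- The coefficient recurrence behind the finite form of the triple product. -/
lemma finite_tripleProduct_term {q z : ℂ} (hq : ‖q‖ < 1) (hq0 : q ≠ 0) (hz : z ≠ 0) (n : ℕ)
    (j : ℤ) :
    qFactorial (q ^ 2) (2 * (n + 1)) * (qFactorialInv (q ^ 2) ((n + 1 : ℕ) - j) *
        qFactorialInv (q ^ 2) ((n + 1 : ℕ) + j)) * (q ^ (j ^ 2) * z ^ j) =
      (1 + q ^ (4 * n + 2)) * (qFactorial (q ^ 2) (2 * n) * (qFactorialInv (q ^ 2) (n - j) *
        qFactorialInv (q ^ 2) (n + j)) * (q ^ (j ^ 2) * z ^ j)) +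
      q ^ (2 * n + 1) * z * (qFactorial (q ^ 2) (2 * n) * (qFactorialInv (q ^ 2) (n - (j - 1)) *
        qFactorialInv (q ^ 2) (n + (j - 1))) * (q ^ ((j - 1) ^ 2) * z ^ (j - 1))) +
      q ^ (2 * n + 1) * z⁻¹ * (qFactorial (q ^ 2) (2 * n) * (qFactorialInv (q ^ 2) (n - (j + 1)) *
        qFactorialInv (q ^ 2) (n + (j + 1))) * (q ^ ((j + 1) ^ 2) * z ^ (j + 1))) := by
  have hQ := norm_pow_lt_one hq two_ne_zero
  have hQ0 : q ^ 2 ≠ 0 := pow_ne_zero _ hq0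
  have e1 : (n : ℤ) - j + 1 = (n + 1 : ℕ) - j := by push_cast; ring
  have e2 : (n : ℤ) + j + 1 = (n + 1 : ℕ) + j := by push_cast; ring
  have r1 : qFactorialInv (q ^ 2) (n - j) = _ := qFactorialInv_eq hQ _
  have r2 : qFactorialInv (q ^ 2) (n + j) = _ := qFactorialInv_eq hQ _
  have r3 : qFactorialInv (q ^ 2) (n - (j + 1)) = _ := qFactorialInv_eq hQ _
  have r4 : qFactorialInv (q ^ 2) (n + (j - 1)) = _ := qFactorialInv_eq hQ _
  rw [show (n : ℤ) - (j + 1) + 1 = n - j by ring, r1, e1] at r3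
  rw [show (n : ℤ) + (j - 1) + 1 = n + j by ring, r2, e2] at r4
  rw [e1] at r1
  rw [e2] at r2
  rw [r1, r2, r3, r4, show (n : ℤ) - (j - 1) = (n + 1 : ℕ) - j by push_cast; ring,
    show (n : ℤ) + (j + 1) = (n + 1 : ℕ) + j by push_cast; ring]
  have hs : q ^ n ≠ 0 := pow_ne_zero _ hq0
  have ht : q ^ j ≠ 0 := zpow_ne_zero _ hq0
  have z1 : (q ^ 2) ^ (((n + 1 : ℕ) : ℤ) - j) = (q ^ n) ^ 2 * q ^ 2 / (q ^ j) ^ 2 := by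
    rw [zpow_sub₀ hQ0, zpow_natCast, ← zpow_natCast q 2, zpow_comm]
    simp only [zpow_natCast]
    congr 1
    ring
  have z2 : (q ^ 2) ^ (((n + 1 : ℕ) : ℤ) + j) = (q ^ n) ^ 2 * q ^ 2 * (q ^ j) ^ 2 := by
    rw [zpow_add₀ hQ0, zpow_natCast, ← zpow_natCast q 2, zpow_comm]
    simp only [zpow_natCast]
    congr 1
    ring
  have z3 : (q ^ 2) ^ ((n : ℤ) - j) = (q ^ n) ^ 2 / (q ^ j) ^ 2 := by
    rw [zpow_sub₀ hQ0, zpow_natCast, ← zpow_natCast q 2, zpow_comm]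
    simp only [zpow_natCast]
    congr 1
    ring
  have z4 : (q ^ 2) ^ ((n : ℤ) + j) = (q ^ n) ^ 2 * (q ^ j) ^ 2 := by
    rw [zpow_add₀ hQ0, zpow_natCast, ← zpow_natCast q 2, zpow_comm]
    simp only [zpow_natCast]
    congr 1
    ring
  have z5 : q ^ ((j - 1) ^ 2) = q ^ (j ^ 2) / (q ^ j) ^ 2 * q := by
    rw [show (j - 1) ^ 2 = j ^ 2 - j * 2 + 1 by ring, zpow_add₀ hq0, zpow_sub₀ hq0, zpow_mul]
    simp
  have z6 : q ^ ((j + 1) ^ 2) = q ^ (j ^ 2) * (q ^ j) ^ 2 * q := by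
    rw [show (j + 1) ^ 2 = j ^ 2 + j * 2 + 1 by ring, zpow_add₀ hq0, zpow_add₀ hq0, zpow_mul]
    simp
  have hD : qFactorial (q ^ 2) (2 * (n + 1)) =
      qFactorial (q ^ 2) (2 * n) * (1 - (q ^ n) ^ 4 * q ^ 2) * (1 - (q ^ n) ^ 4 * q ^ 4) := by
    rw [Nat.mul_succ]
    simp only [qFactorial, prod_range_succ]
    ring
  rw [z1, z2, z3, z4, z5, z6, hD, zpow_sub_one₀ hz, zpow_add_one₀ hz,
    show q ^ (4 * n + 2) = (q ^ n) ^ 4 * q ^ 2 by ring,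
    show q ^ (2 * n + 1) = (q ^ n) ^ 2 * q by ring]
  generalize qFactorialInv (q ^ 2) ((n + 1 : ℕ) - j) = A
  generalize qFactorialInv (q ^ 2) ((n + 1 : ℕ) + j) = B
  generalize qFactorial (q ^ 2) (2 * n) = D
  generalize q ^ (j ^ 2) = E
  generalize z ^ j = Z
  generalize q ^ n = s at *
  generalize q ^ j = t at *
  field_simp
  ring

/-- The finite form of the triple product: its coefficients are Gaussian binomial coefficients
`[2n choose n + j]` in `q²`. -/
lemma hasSum_finite_tripleProduct {q z : ℂ} (hq : ‖q‖ < 1) (hq0 : q ≠ 0) (hz : z ≠ 0) (n : ℕ) :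
    HasSum (fun j : ℤ => qFactorial (q ^ 2) (2 * n) * (qFactorialInv (q ^ 2) (n - j) *
        qFactorialInv (q ^ 2) (n + j)) * (q ^ (j ^ 2) * z ^ j))
      ((∏ k ∈ range n, (1 - -z * q * (q ^ 2) ^ k)) *
        ∏ k ∈ range n, (1 - -z⁻¹ * q * (q ^ 2) ^ k)) := by
  induction n with
  | zero =>
    have h := hasSum_single (f := fun j : ℤ => qFactorial (q ^ 2) (2 * 0) *
      (qFactorialInv (q ^ 2) ((0 : ℕ) - j) * qFactorialInv (q ^ 2) ((0 : ℕ) + j)) *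
      (q ^ (j ^ 2) * z ^ j)) 0 fun j hj => by
        rcases lt_or_gt_of_ne hj with h | h <;> simp [qFactorialInv, h]
    simpa [qFactorial, qFactorialInv] using h
  | succ n ih =>
    have hm := (Equiv.subRight (1 : ℤ)).hasSum_iff.2 ih
    have hp := (Equiv.addRight (1 : ℤ)).hasSum_iff.2 ih
    have h := ((ih.mul_left (1 + q ^ (4 * n + 2))).add (hm.mul_left (q ^ (2 * n + 1) * z))).add
      (hp.mul_left (q ^ (2 * n + 1) * z⁻¹))
    convert! h using 1
    · funext j
      exact finite_tripleProduct_term hq hq0 hz n j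
    · simp only [prod_range_succ]
      generalize ∏ k ∈ range n, (1 - -z * q * (q ^ 2) ^ k) = A
      generalize ∏ k ∈ range n, (1 - -z⁻¹ * q * (q ^ 2) ^ k) = B
      field_simp
      ring

lemma summable_nat_pow_sq_mul_pow {r : ℝ} (hr : 0 < r) (hr1 : r < 1) {b : ℝ} (hb : 0 < b) :
    Summable fun n : ℕ => r ^ (n ^ 2) * b ^ n := by
  have h : Tendsto (fun n : ℕ => r ^ n * b) atTop (𝓝 0) := by
    simpa using (tendsto_pow_atTop_nhds_zero_of_lt_one hr.le hr1).mul_const b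
  refine Summable.of_norm_bounded_eventually_nat (g := fun n : ℕ => (1 / 2 : ℝ) ^ n)
    (summable_geometric_of_lt_one (by norm_num) (by norm_num)) ?_
  filter_upwards [h.eventually_le_const (by norm_num : (0 : ℝ) < 1 / 2)] with n hn
  rw [Real.norm_of_nonneg (by positivity), sq, pow_mul, ← mul_pow]
  exact pow_le_pow_left₀ (by positivity) hn n

lemma summable_int_zpow_sq_mul_zpow {r : ℝ} (hr : 0 < r) (hr1 : r < 1) {b : ℝ} (hb : 0 < b) :
    Summable fun n : ℤ => r ^ (n ^ 2) * b ^ n := by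
  refine Summable.of_nat_of_neg ?_ ?_
  · refine (summable_nat_pow_sq_mul_pow hr hr1 hb).congr fun n => ?_
    rw [← Nat.cast_pow, zpow_natCast, zpow_natCast]
  · refine (summable_nat_pow_sq_mul_pow hr hr1 (inv_pos.2 hb)).congr fun n => ?_
    rw [neg_sq, ← Nat.cast_pow, zpow_natCast, zpow_neg, zpow_natCast, inv_pow]

lemma tendsto_qFactorial {Q : ℂ} (hQ : ‖Q‖ < 1) :
    Tendsto (qFactorial Q) atTop (𝓝 (qPochhammerInf Q Q)) :=
  (multipliable_qPochhammerInf Q Q hQ).tendsto_prod_tprod_nat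

lemma tendsto_qFactorialInv {Q : ℂ} (hQ : ‖Q‖ < 1) :
    Tendsto (fun m : ℕ => qFactorialInv Q m) atTop (𝓝 (qPochhammerInf Q Q)⁻¹) := by
  refine ((tendsto_qFactorial hQ).inv₀ (qPochhammerInf_self_ne_zero hQ)).congr fun m => ?_
  simp [qFactorialInv]

/-- **Jacobi's triple product identity**. -/
theorem hasSum_tripleProduct {q z : ℂ} (hq : ‖q‖ < 1) (hq0 : q ≠ 0) (hz : z ≠ 0) :
    HasSum (fun n : ℤ => q ^ (n ^ 2) * z ^ n)
      (qPochhammerInf (-z * q) (q ^ 2) * qPochhammerInf (-z⁻¹ * q) (q ^ 2) *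
        qPochhammerInf (q ^ 2) (q ^ 2)) := by
  have hQ := norm_pow_lt_one hq two_ne_zero
  have hP := qPochhammerInf_self_ne_zero hQ
  -- In the finite form, the coefficients are bounded and tend to `1 / (q²; q²)_∞`: dominated
  -- convergence applies.
  have hsum : Summable fun n : ℤ => ‖q ^ (n ^ 2) * z ^ n‖ := by
    simpa only [norm_mul, norm_zpow] using
      summable_int_zpow_sq_mul_zpow (norm_pos_iff.2 hq0) hq (norm_pos_iff.2 hz)
  obtain ⟨C₁, hC₁⟩ := (tendsto_qFactorial hQ).norm.bddAbove_range
  obtain ⟨C₂, hC₂⟩ := (tendsto_qFactorialInv hQ).norm.bddAbove_range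
  replace hC₁ (n : ℕ) : ‖qFactorial (q ^ 2) n‖ ≤ C₁ := hC₁ ⟨n, rfl⟩
  have hC₂0 : 0 ≤ C₂ := (norm_nonneg _).trans (hC₂ ⟨0, rfl⟩)
  have hC₁0 : 0 ≤ C₁ := (norm_nonneg _).trans (hC₁ 0)
  replace hC₂ (m : ℤ) : ‖qFactorialInv (q ^ 2) m‖ ≤ C₂ := by
    rcases lt_or_ge m 0 with hm | hm
    · simpa [qFactorialInv, hm] using hC₂0
    · lift m to ℕ using hm
      exact hC₂ ⟨m, rfl⟩
  have hint (f : ℕ → ℤ) (hf : Tendsto f atTop atTop) :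
      Tendsto (fun n => qFactorialInv (q ^ 2) (f n)) atTop
        (𝓝 (qPochhammerInf (q ^ 2) (q ^ 2))⁻¹) := by
    have hf' : Tendsto (fun n => (f n).toNat) atTop atTop :=
      tendsto_atTop_atTop.2 fun b => by
        obtain ⟨N, hN⟩ := tendsto_atTop_atTop.1 hf b
        exact ⟨N, fun n hn => by have := hN n hn; omega⟩
    refine ((tendsto_qFactorialInv hQ).comp hf').congr' ?_
    filter_upwards [hf.eventually_ge_atTop 0] with n hn
    simp [Int.toNat_of_nonneg hn]
  have hlim := tendsto_tsum_of_dominated_convergence (𝓕 := atTop)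
    (f := fun (n : ℕ) (j : ℤ) => qFactorial (q ^ 2) (2 * n) * (qFactorialInv (q ^ 2) (n - j) *
        qFactorialInv (q ^ 2) (n + j)) * (q ^ (j ^ 2) * z ^ j))
    (g := fun j : ℤ => qPochhammerInf (q ^ 2) (q ^ 2) * ((qPochhammerInf (q ^ 2) (q ^ 2))⁻¹ *
      (qPochhammerInf (q ^ 2) (q ^ 2))⁻¹) * (q ^ (j ^ 2) * z ^ j))
    (hsum.mul_left (C₁ * (C₂ * C₂))) (fun j => by
      refine Tendsto.mul_const _ (Tendsto.mul ?_ (Tendsto.mul ?_ ?_))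
      · exact (tendsto_qFactorial hQ).comp
          (tendsto_id.const_mul_atTop' (r := 2) (by norm_num))
      · exact hint _ (tendsto_atTop_add_const_right _ (-j) tendsto_natCast_atTop_atTop)
      · exact hint _ (tendsto_atTop_add_const_right _ j tendsto_natCast_atTop_atTop))
    (Eventually.of_forall fun n j => by
      rw [norm_mul _ (q ^ (j ^ 2) * z ^ j), norm_mul, norm_mul (qFactorialInv _ _)]
      gcongr
      exacts [hC₁ _, hC₂ _, hC₂ _])
  simp only [fun n => (hasSum_finite_tripleProduct hq hq0 hz n).tsum_eq] at hlim
  have hprod := ((multipliable_qPochhammerInf (-z * q) (q ^ 2) hQ).tendsto_prod_tprod_nat).mul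
    (multipliable_qPochhammerInf (-z⁻¹ * q) (q ^ 2) hQ).tendsto_prod_tprod_nat
  have heq := tendsto_nhds_unique hprod hlim
  rw [tsum_mul_left] at heq
  rw [hsum.of_norm.hasSum_iff]
  simp only [qPochhammerInf] at heq hP ⊢
  rw [heq]
  field_simp

/-! ### Generating functions -/

lemma card_overpartition (n : ℕ) :
    Nat.card (Overpartition n) = (Nat.Partition.genFun fun _ _ => (2 : ℕ)).coeff n := by
  let e : Overpartition n ≃ Σ p : n.Partition, {s : Finset ℕ // s ∈ p.parts.toFinset.powerset} :=
    { toFun := fun o => ⟨o.toPartition, o.overlined, mem_powerset.2 o.overlined_subset⟩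
      invFun := fun x => ⟨x.1, x.2.1, mem_powerset.1 x.2.2⟩
      left_inv := fun _ => rfl
      right_inv := fun _ => rfl }
  rw [Nat.card_congr e, Nat.card_eq_fintype_card, Fintype.card_sigma, Nat.Partition.coeff_genFun]
  refine sum_congr rfl fun p _ => ?_
  simp [Finsupp.prod]

lemma overpartitionPairCount_eq_sum (n : ℕ) :
    overpartitionPairCount n = ∑ ij ∈ antidiagonal n,
      Nat.card (Overpartition ij.1) * Nat.card (Overpartition ij.2) := by
  rw [overpartitionPairCount, Nat.card_sigma]
  simp only [Nat.card_prod]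
  exact sum_coe_sort (antidiagonal n)
    fun ij => Nat.card (Overpartition ij.1) * Nat.card (Overpartition ij.2)

open scoped PowerSeries PowerSeries.WithPiTopology

lemma one_add_tsum_smul_X_pow_eq_mk {R : Type*} [CommSemiring R] [TopologicalSpace R] [T2Space R]
    (c : R) (i : ℕ) :
    1 + ∑' j : ℕ, c • (PowerSeries.X : R⟦X⟧) ^ ((i + 1) * (j + 1)) =
      PowerSeries.mk fun n => if n = 0 then 1 else if i + 1 ∣ n then c else 0 := by
  have hs := Nat.Partition.summable_genFun_term (fun _ _ => c) i
  ext n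
  rw [map_add, hs.map_tsum _ (PowerSeries.WithPiTopology.continuous_coeff _ _),
    PowerSeries.coeff_mk]
  simp only [map_smul, PowerSeries.coeff_X_pow, PowerSeries.coeff_one, smul_eq_mul]
  rcases Nat.eq_zero_or_pos n with rfl | hn
  · simp
  rw [if_neg hn.ne', if_neg hn.ne', zero_add]
  by_cases hd : i + 1 ∣ n
  · obtain ⟨k, rfl⟩ := hd
    have hk : k ≠ 0 := by rintro rfl; simp at hn
    obtain ⟨k, rfl⟩ := Nat.exists_eq_succ_of_ne_zero hk
    rw [tsum_eq_single k]
    · simp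
    · intro j hj
      simp [Ne.symm hj]
  · rw [if_neg hd]
    refine (tsum_congr fun j => ?_).trans tsum_zero
    rw [if_neg (fun h => hd ⟨_, h⟩), mul_zero]

/-- The factor `(1 + X ^ (i + 1)) / (1 - X ^ (i + 1))` of the generating function of overpartitions:
the part `i + 1` does not occur, or it occurs and may be overlined. -/
noncomputable def overpartitionFactor (i : ℕ) : ℕ⟦X⟧ :=
  PowerSeries.mk fun n => if n = 0 then 1 else if i + 1 ∣ n then 2 else 0

/-- The formal product expansion of the generating function of overpartitions, coefficientwise. -/
lemma eventually_coeff_prod_overpartitionFactor (n : ℕ) :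
    ∀ᶠ N in atTop, (∏ i ∈ range N, overpartitionFactor i).coeff n =
      Nat.card (Overpartition n) := by
  have h := (Nat.Partition.hasProd_genFun fun _ _ => (2 : ℕ)).tendsto_prod_nat
  simp only [one_add_tsum_smul_X_pow_eq_mk] at h
  have h' := (PowerSeries.WithPiTopology.tendsto_iff_coeff_tendsto _ _ _ _).1 h n
  rw [← card_overpartition, nhds_discrete] at h'
  exact tendsto_pure.1 h'

lemma coeff_prod_overpartitionFactor_le (N n : ℕ) :
    (∏ i ∈ range N, overpartitionFactor i).coeff n ≤ Nat.card (Overpartition n) := by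
  have hmono : Monotone fun N => (∏ i ∈ range N, overpartitionFactor i).coeff n := by
    refine monotone_nat_of_le_succ fun N => ?_
    rw [prod_range_succ, PowerSeries.coeff_mul]
    have hmem : (n, 0) ∈ antidiagonal n := by simp
    refine le_trans ?_ (single_le_sum (fun _ _ => Nat.zero_le _) hmem)
    simp [overpartitionFactor]
  obtain ⟨M, hM⟩ := eventually_atTop.1 (eventually_coeff_prod_overpartitionFactor n)
  exact (hmono (le_max_left N M)).trans (hM _ (le_max_right N M)).le

/-- `P` converges absolutely at `q`, to the value `v`. -/
def PowerSeries.HasAbsEval (P : ℕ⟦X⟧) (q v : ℂ) : Prop :=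
  (Summable fun n => ‖(P.coeff n : ℂ) * q ^ n‖) ∧ ∑' n, (P.coeff n : ℂ) * q ^ n = v

lemma PowerSeries.HasAbsEval.mul {P R : ℕ⟦X⟧} {q v w : ℂ} (hP : P.HasAbsEval q v)
    (hR : R.HasAbsEval q w) : (P * R).HasAbsEval q (v * w) := by
  have key (n : ℕ) : ∑ kl ∈ antidiagonal n, (P.coeff kl.1 : ℂ) * q ^ kl.1 *
      ((R.coeff kl.2 : ℂ) * q ^ kl.2) = ((P * R).coeff n : ℂ) * q ^ n := by
    rw [PowerSeries.coeff_mul, Nat.cast_sum, sum_mul]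
    refine sum_congr rfl fun kl hkl => ?_
    rw [← mem_antidiagonal.1 hkl]
    push_cast
    ring
  refine ⟨?_, ?_⟩
  · simpa only [key] using summable_norm_sum_mul_antidiagonal_of_summable_norm hP.1 hR.1
  · rw [← hP.2, ← hR.2, tsum_mul_tsum_eq_tsum_sum_antidiagonal_of_summable_norm hP.1 hR.1]
    exact tsum_congr fun n => (key n).symm

lemma hasAbsEval_overpartitionFactor (i : ℕ) {q : ℂ} (hq : ‖q‖ < 1) :
    (overpartitionFactor i).HasAbsEval q ((1 + q ^ (i + 1)) / (1 - q ^ (i + 1))) := by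
  have habs : Summable fun n => ‖((overpartitionFactor i).coeff n : ℂ) * q ^ n‖ := by
    refine Summable.of_nonneg_of_le (fun _ => norm_nonneg _) (fun n => ?_)
      ((summable_geometric_of_lt_one (norm_nonneg q) hq).mul_left 2)
    rw [norm_mul, norm_pow]
    gcongr
    rw [overpartitionFactor, PowerSeries.coeff_mk]
    split_ifs <;> simp
  refine ⟨habs, HasSum.tsum_eq ?_⟩
  have hx := norm_pow_lt_one hq (Nat.succ_ne_zero i)
  have hinj : Function.Injective fun j : ℕ => (i + 1) * j :=
    fun a b h => Nat.eq_of_mul_eq_mul_left (Nat.succ_pos i) h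
  rw [← hinj.hasSum_iff]
  · have hg := ((hasSum_geometric_of_norm_lt_one hx).mul_left 2).sub
      (hasSum_single (f := fun n : ℕ => if n = 0 then (1 : ℂ) else 0) 0 (by simp +contextual))
    convert! hg using 1
    · funext j
      rcases Nat.eq_zero_or_pos j with rfl | hj
      · simp [overpartitionFactor]; norm_num
      · simp [overpartitionFactor, hj.ne', pow_mul]
    · have : 1 - q ^ (i + 1) ≠ 0 := by
        intro h
        rw [← sub_eq_zero.1 h] at hx
        simp at hx
      simp only [Nat.succ_eq_add_one, if_true]
      field_simp
      ring
  · intro n hn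
    have hd : ¬ (i + 1 ∣ n) := fun ⟨k, hk⟩ => hn ⟨k, hk.symm⟩
    have h0 : n ≠ 0 := fun h => hd (h ▸ dvd_zero _)
    simp [overpartitionFactor, hd, h0]

lemma hasAbsEval_prod_overpartitionFactor (N : ℕ) {q : ℂ} (hq : ‖q‖ < 1) :
    (∏ i ∈ range N, overpartitionFactor i).HasAbsEval q
      ((∏ i ∈ range N, (1 - -q * q ^ i)) / ∏ i ∈ range N, (1 - q * q ^ i)) := by
  induction N with
  | zero =>
    have h' := hasSum_single (f := fun n => ‖((1 : ℕ⟦X⟧).coeff n : ℂ) * q ^ n‖) 0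
      fun n hn => by simp [PowerSeries.coeff_one, hn]
    exact ⟨h'.summable, by simp⟩
  | succ N ih =>
    rw [prod_range_succ, prod_range_succ, prod_range_succ, mul_div_mul_comm]
    have h := hasAbsEval_overpartitionFactor N hq
    rw [show (1 + q ^ (N + 1)) / (1 - q ^ (N + 1)) = (1 - -q * q ^ N) / (1 - q * q ^ N) by
      ring_nf] at h
    exact ih.mul h

lemma tendsto_prod_div_prod {q : ℂ} (hq : ‖q‖ < 1) :
    Tendsto (fun N => (∏ i ∈ range N, (1 - -q * q ^ i)) / ∏ i ∈ range N, (1 - q * q ^ i)) atTop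
      (𝓝 (qPochhammerInf (-q) q / qPochhammerInf q q)) :=
  (multipliable_qPochhammerInf (-q) q hq).tendsto_prod_tprod_nat.div
    (multipliable_qPochhammerInf q q hq).tendsto_prod_tprod_nat (qPochhammerInf_self_ne_zero hq)

lemma summable_card_overpartition {q : ℂ} (hq : ‖q‖ < 1) :
    Summable fun n => ‖(Nat.card (Overpartition n) : ℂ) * q ^ n‖ := by
  have hr : ‖(‖q‖ : ℂ)‖ < 1 := by simpa using hq
  obtain ⟨C, hC⟩ := (tendsto_prod_div_prod hr).norm.bddAbove_range
  refine summable_of_sum_le (c := C) (fun _ => norm_nonneg _) fun s => ?_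
  -- A partial sum at `‖q‖` is at most the value of a finite product, as the terms are nonnegative.
  obtain ⟨N, hN⟩ := ((s.eventually_all).2 fun n _ =>
    eventually_coeff_prod_overpartitionFactor n).exists
  have hE := hasAbsEval_prod_overpartitionFactor N hr
  calc ∑ n ∈ s, ‖(Nat.card (Overpartition n) : ℂ) * q ^ n‖
      = ∑ n ∈ s, ‖((∏ i ∈ range N, overpartitionFactor i).coeff n : ℂ) * (‖q‖ : ℂ) ^ n‖ :=
        sum_congr rfl fun n hn => by rw [hN n hn]; simp
    _ ≤ ∑' n, ‖((∏ i ∈ range N, overpartitionFactor i).coeff n : ℂ) * (‖q‖ : ℂ) ^ n‖ :=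
        hE.1.sum_le_tsum s fun _ _ => norm_nonneg _
    _ = ‖∑' n, ((∏ i ∈ range N, overpartitionFactor i).coeff n : ℂ) * (‖q‖ : ℂ) ^ n‖ := by
        have hreal (n : ℕ) : ((∏ i ∈ range N, overpartitionFactor i).coeff n : ℂ) * (‖q‖ : ℂ) ^ n =
            ((((∏ i ∈ range N, overpartitionFactor i).coeff n : ℝ) * ‖q‖ ^ n : ℝ) : ℂ) := by
          push_cast; rfl
        have hnn (n : ℕ) : 0 ≤ ((∏ i ∈ range N, overpartitionFactor i).coeff n : ℝ) * ‖q‖ ^ n := by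
          positivity
        simp only [hreal, ← Complex.ofReal_tsum, Complex.norm_real]
        rw [Real.norm_of_nonneg (tsum_nonneg hnn)]
        exact tsum_congr fun n => Real.norm_of_nonneg (hnn n)
    _ ≤ C := by rw [hE.2]; exact hC ⟨N, rfl⟩

lemma tsum_card_overpartition {q : ℂ} (hq : ‖q‖ < 1) :
    ∑' n, (Nat.card (Overpartition n) : ℂ) * q ^ n =
      qPochhammerInf (-q) q / qPochhammerInf q q := by
  refine tendsto_nhds_unique (tendsto_tsum_of_dominated_convergence (𝓕 := atTop)
    (f := fun N n => ((∏ i ∈ range N, overpartitionFactor i).coeff n : ℂ) * q ^ n)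
    (summable_card_overpartition hq) (fun n => ?_) (Eventually.of_forall fun N n => ?_))
    ((tendsto_prod_div_prod hq).congr fun N => (hasAbsEval_prod_overpartitionFactor N hq).2.symm)
  · refine tendsto_nhds_of_eventually_eq ?_
    filter_upwards [eventually_coeff_prod_overpartitionFactor n] with N hN
    rw [hN]
  · rw [norm_mul, norm_mul, Complex.norm_natCast, Complex.norm_natCast]
    gcongr
    exact coeff_prod_overpartitionFactor_le N n

/-- The generating function of overpartition pairs. -/
theorem hasSum_overpartitionPairCount {q : ℂ} (hq : ‖q‖ < 1) :
    HasSum (fun n => (overpartitionPairCount n : ℂ) * q ^ n)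
      ((qPochhammerInf (q ^ 2) (q ^ 2) / qPochhammerInf q q ^ 2) ^ 2) := by
  have key (n : ℕ) : ∑ ij ∈ antidiagonal n, (Nat.card (Overpartition ij.1) : ℂ) * q ^ ij.1 *
      ((Nat.card (Overpartition ij.2) : ℂ) * q ^ ij.2) =
      (overpartitionPairCount n : ℂ) * q ^ n := by
    rw [overpartitionPairCount_eq_sum, Nat.cast_sum, sum_mul]
    refine sum_congr rfl fun ij hij => ?_
    rw [← mem_antidiagonal.1 hij]
    push_cast
    ring
  have hs := summable_card_overpartition hq
  have h1 := (summable_norm_sum_mul_antidiagonal_of_summable_norm hs hs).of_norm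
  have h2 := tsum_mul_tsum_eq_tsum_sum_antidiagonal_of_summable_norm hs hs
  simp only [key, tsum_card_overpartition hq] at h1 h2
  rw [h1.hasSum_iff, ← h2, ← qPochhammerInf_self_mul_neg hq]
  have := qPochhammerInf_self_ne_zero hq
  field_simp

/-! ### Theta functions -/

/-- Ramanujan's theta function `φ(q) = ∑ q ^ (n ^ 2)`, the sum over all integers `n`, encoded by its
product expansion (see `hasSum_ramanujanPhi`). -/
noncomputable def ramanujanPhi (q : ℂ) : ℂ :=
  qPochhammerInf (-q) (-q) ^ 2 / qPochhammerInf (q ^ 2) (q ^ 2)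

/-- Ramanujan's theta function `ψ(q) = ∑ q ^ (n * (n + 1) / 2)`, the sum over all natural numbers
`n`, encoded by its product expansion (see `hasSum_ramanujanPsi`). -/
noncomputable def ramanujanPsi (q : ℂ) : ℂ :=
  qPochhammerInf (q ^ 2) (q ^ 2) ^ 2 / qPochhammerInf q q

/-- The function `∑ (-1) ^ n * q ^ (3 * n ^ 2 + 2 * n)`, the sum over all integers `n`, encoded by
its product expansion (see `hasSum_ramanujanOmega`). -/
noncomputable def ramanujanOmega (q : ℂ) : ℂ :=
  qPochhammerInf q q * qPochhammerInf (q ^ 6) (q ^ 6) ^ 2 /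
    (qPochhammerInf (q ^ 2) (q ^ 2) * qPochhammerInf (q ^ 3) (q ^ 3))

lemma ramanujanPhi_neg (q : ℂ) :
    ramanujanPhi (-q) = qPochhammerInf q q ^ 2 / qPochhammerInf (q ^ 2) (q ^ 2) := by
  simp [ramanujanPhi]

lemma ramanujanPhi_ne_zero {q : ℂ} (hq : ‖q‖ < 1) : ramanujanPhi q ≠ 0 :=
  div_ne_zero (pow_ne_zero _ (qPochhammerInf_self_ne_zero (by simpa using hq)))
    (qPochhammerInf_self_ne_zero (norm_pow_lt_one hq two_ne_zero))

lemma hasSum_ramanujanPhi {q : ℂ} (hq : ‖q‖ < 1) (hq0 : q ≠ 0) :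
    HasSum (fun n : ℤ => q ^ (n ^ 2)) (ramanujanPhi q) := by
  -- The triple product at `z = 1`.
  have h := hasSum_tripleProduct hq hq0 one_ne_zero
  have hs := qPochhammerInf_split_two (-q) (q := -q) (by simpa using hq)
  have h2 := qPochhammerInf_self_ne_zero (norm_pow_lt_one hq two_ne_zero)
  simp only [neg_sq, ← sq] at hs
  simp only [one_zpow, mul_one, inv_one, neg_one_mul] at h
  convert! h using 1
  rw [ramanujanPhi, hs]
  field_simp

/-- The series of `ψ(q ^ 8)` in the form in which it occurs in that of `φ(q)`: the odd squares are
`(2 * n + 1) ^ 2 = 1 + (4 * n ^ 2 + 4 * n)`, and the sum over all integers counts each of them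
twice. -/
lemma hasSum_ramanujanPsi {q : ℂ} (hq : ‖q‖ < 1) (hq0 : q ≠ 0) :
    HasSum (fun n : ℤ => q ^ (4 * n ^ 2 + 4 * n)) (2 * ramanujanPsi (q ^ 8)) := by
  have h := hasSum_tripleProduct (norm_pow_lt_one hq four_ne_zero) (pow_ne_zero 4 hq0)
    (pow_ne_zero 4 hq0)
  have hq8 := norm_pow_lt_one hq (by norm_num : 8 ≠ 0)
  have h1 := qPochhammerInf_eq_mul_succ (-1) hq8
  have h2 := qPochhammerInf_self_mul_neg hq8
  have h3 := qPochhammerInf_self_ne_zero hq8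
  have e : -(q ^ 4)⁻¹ * q ^ 4 = -1 := by rw [neg_mul, inv_mul_cancel₀ (pow_ne_zero 4 hq0)]
  rw [e, show -q ^ 4 * q ^ 4 = -q ^ 8 by ring, ← pow_mul, h1] at h
  convert! h using 1
  · funext n
    rw [zpow_add₀ hq0, zpow_mul, zpow_mul]
    norm_cast
  · rw [ramanujanPsi, ← h2]
    field_simp
    ring_nf

/-- The series of `Ω(q ^ 3)` in the form in which it occurs in that of `φ(-q)`: the squares prime to
`3` are `(3 * n + 1) ^ 2 = 1 + (9 * n ^ 2 + 6 * n)`. -/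
lemma hasSum_ramanujanOmega {q : ℂ} (hq : ‖q‖ < 1) (hq0 : q ≠ 0) :
    HasSum (fun n : ℤ => (-q) ^ (9 * n ^ 2 + 6 * n)) (ramanujanOmega (q ^ 3)) := by
  have hn : -q ≠ 0 := neg_ne_zero.2 hq0
  have hnn : ‖-q‖ < 1 := by simpa using hq
  have h := hasSum_tripleProduct (norm_pow_lt_one hnn (by norm_num : 9 ≠ 0)) (pow_ne_zero 9 hn)
    (pow_ne_zero 6 hn)
  have hq3 := norm_pow_lt_one hq three_ne_zero
  have h1 := qPochhammerInf_one_mul_five hq3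
  have h2 := qPochhammerInf_self_ne_zero (norm_pow_lt_one hq3 two_ne_zero)
  have h3 := qPochhammerInf_self_ne_zero (norm_pow_lt_one hq3 three_ne_zero)
  have e : -((-q) ^ 6)⁻¹ * (-q) ^ 9 = q ^ 3 := by field_simp
  rw [e, show -(-q) ^ 6 * (-q) ^ 9 = (q ^ 3) ^ 5 by ring,
    show ((-q) ^ 9) ^ 2 = (q ^ 3) ^ 6 by ring] at h
  convert! h using 1
  · funext n
    rw [zpow_add₀ hn, zpow_mul, zpow_mul]
    norm_cast
  · rw [ramanujanOmega, div_eq_iff (mul_ne_zero h2 h3)]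
    linear_combination -qPochhammerInf ((q ^ 3) ^ 6) ((q ^ 3) ^ 6) * h1

/-- Restriction of a sum over the integers to a residue class. -/
lemma hasSum_ite_residue {m r : ℤ} (hm : m ≠ 0) {g : ℤ → ℂ} {s : ℂ}
    (h : HasSum (fun n => g (m * n + r)) s) :
    HasSum (fun n => if m ∣ n - r then g n else 0) s := by
  have hinj : Function.Injective fun n : ℤ => m * n + r :=
    fun a b hab => mul_left_cancel₀ hm (add_right_cancel hab)
  rw [← hinj.hasSum_iff]
  · simpa [Function.comp_def] using h
  · intro n hn
    refine if_neg fun ⟨k, hk⟩ => hn ⟨k, ?_⟩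
    simp only [← hk, sub_add_cancel]

/-- The `2`-dissection of `φ`. -/
lemma ramanujanPhi_eq_two {q : ℂ} (hq : ‖q‖ < 1) (hq0 : q ≠ 0) :
    ramanujanPhi q = ramanujanPhi (q ^ 4) + 2 * q * ramanujanPsi (q ^ 8) := by
  have h0 := hasSum_ite_residue (m := 2) (r := 0) two_ne_zero (g := fun n : ℤ => q ^ (n ^ 2))
    (s := ramanujanPhi (q ^ 4)) <| by
      convert! hasSum_ramanujanPhi (norm_pow_lt_one hq four_ne_zero) (pow_ne_zero 4 hq0) using 2
        with n
      rw [show (2 * n + 0) ^ 2 = 4 * n ^ 2 by ring, zpow_mul]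
      norm_cast
  have h1 := hasSum_ite_residue (m := 2) (r := 1) two_ne_zero (g := fun n : ℤ => q ^ (n ^ 2))
    (s := q * (2 * ramanujanPsi (q ^ 8))) <| by
      convert! (hasSum_ramanujanPsi hq hq0).mul_left q using 2 with n
      rw [show (2 * n + 1) ^ 2 = 1 + (4 * n ^ 2 + 4 * n) by ring, zpow_one_add₀ hq0]
  refine (hasSum_ramanujanPhi hq hq0).unique ?_
  convert! h0.add h1 using 1
  · funext n
    rcases Int.emod_two_eq_zero_or_one n with h | h
    · rw [if_pos (by omega), if_neg (by omega), add_zero]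
    · rw [if_neg (by omega), if_pos (by omega), zero_add]
  · ring

/-- The `3`-dissection of `φ(-q)`. -/
lemma ramanujanPhi_neg_eq_three {q : ℂ} (hq : ‖q‖ < 1) (hq0 : q ≠ 0) :
    ramanujanPhi (-q) = ramanujanPhi (-q ^ 9) - 2 * q * ramanujanOmega (q ^ 3) := by
  have hn : -q ≠ 0 := neg_ne_zero.2 hq0
  have h0 := hasSum_ite_residue (m := 3) (r := 0) three_ne_zero (g := fun n : ℤ => (-q) ^ (n ^ 2))
    (s := ramanujanPhi (-q ^ 9)) <| by
      have h9 : ‖-q ^ 9‖ < 1 := by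
        rw [norm_neg]
        exact norm_pow_lt_one hq (by norm_num)
      convert! hasSum_ramanujanPhi h9 (neg_ne_zero.2 (pow_ne_zero 9 hq0)) using 2 with n
      rw [show (3 * n + 0) ^ 2 = 9 * n ^ 2 by ring, zpow_mul]
      congr 1
      norm_cast
      ring
  have hO := (hasSum_ramanujanOmega hq hq0).mul_left (-q)
  have h1 := hasSum_ite_residue (m := 3) (r := 1) three_ne_zero (g := fun n : ℤ => (-q) ^ (n ^ 2))
    (s := -q * ramanujanOmega (q ^ 3)) <| by
      convert! hO using 2 with n
      rw [show (3 * n + 1) ^ 2 = 1 + (9 * n ^ 2 + 6 * n) by ring, zpow_one_add₀ hn]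
  have h2 := hasSum_ite_residue (m := 3) (r := -1) three_ne_zero
    (g := fun n : ℤ => (-q) ^ (n ^ 2)) (s := -q * ramanujanOmega (q ^ 3)) <| by
      rw [← (Equiv.neg ℤ).hasSum_iff]
      convert! hO using 2 with n
      simp only [Function.comp_apply, Equiv.neg_apply]
      rw [show (3 * -n + -1) ^ 2 = 1 + (9 * n ^ 2 + 6 * n) by ring, zpow_one_add₀ hn]
  refine (hasSum_ramanujanPhi (by simpa using hq) hn).unique ?_
  convert! (h0.add h1).add h2 using 1
  · funext n
    have : n % 3 = 0 ∨ n % 3 = 1 ∨ n % 3 = 2 := by omega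
    rcases this with h | h | h
    · rw [if_pos (by omega), if_neg (by omega), if_neg (by omega), add_zero, add_zero]
    · rw [if_neg (by omega), if_pos (by omega), if_neg (by omega), zero_add, add_zero]
    · rw [if_neg (by omega), if_neg (by omega), if_pos (by omega), zero_add, zero_add]
  · ring

lemma ramanujanPhi_mul_neg {q : ℂ} (hq : ‖q‖ < 1) :
    ramanujanPhi q * ramanujanPhi (-q) = ramanujanPhi (-q ^ 2) ^ 2 := by
  have h1 := qPochhammerInf_self_ne_zero hq
  have h2 := qPochhammerInf_self_ne_zero (norm_pow_lt_one hq two_ne_zero)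
  have h4 := qPochhammerInf_self_ne_zero (norm_pow_lt_one hq four_ne_zero)
  have h := qPochhammerInf_neg_self hq
  rw [← eq_div_iff (mul_ne_zero h1 h4)] at h
  rw [ramanujanPhi_neg, ramanujanPhi_neg, ramanujanPhi, h, ← pow_mul]
  norm_num
  field_simp

lemma ramanujanPhi_mul_ramanujanPsi_sq {q : ℂ} (hq : ‖q‖ < 1) :
    ramanujanPhi q * ramanujanPsi (q ^ 2) = ramanujanPsi q ^ 2 := by
  have h1 := qPochhammerInf_self_ne_zero hq
  have h2 := qPochhammerInf_self_ne_zero (norm_pow_lt_one hq two_ne_zero)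
  have h4 := qPochhammerInf_self_ne_zero (norm_pow_lt_one hq four_ne_zero)
  have h := qPochhammerInf_neg_self hq
  rw [← eq_div_iff (mul_ne_zero h1 h4)] at h
  rw [ramanujanPhi, ramanujanPsi, ramanujanPsi, h, ← pow_mul]
  norm_num
  field_simp

/-- The `2`-dissection of `φ ^ 2`. It is the product of the `2`-dissections of `φ(x)` and `φ(-x)`,
where `x ^ 2 = -q`. -/
lemma ramanujanPhi_sq {q : ℂ} (hq : ‖q‖ < 1) (hq0 : q ≠ 0) :
    ramanujanPhi q ^ 2 = ramanujanPhi (q ^ 2) ^ 2 + 4 * q * ramanujanPsi (q ^ 4) ^ 2 := by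
  obtain ⟨x, hx⟩ := IsAlgClosed.exists_pow_nat_eq (-q) two_pos
  have hx0 : x ≠ 0 := by
    rintro rfl
    exact hq0 (by simpa using hx.symm)
  have hx1 : ‖x‖ < 1 := by
    rw [← pow_lt_one_iff_of_nonneg (norm_nonneg x) two_ne_zero, ← norm_pow, hx, norm_neg]
    exact hq
  have h := ramanujanPhi_mul_neg hx1
  rw [ramanujanPhi_eq_two hx1 hx0, ramanujanPhi_eq_two (q := -x) (by simpa using hx1)
    (neg_ne_zero.2 hx0), hx, neg_neg, show (-x) ^ 4 = (x ^ 2) ^ 2 by ring,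
    show (-x) ^ 8 = (x ^ 2) ^ 4 by ring, show x ^ 4 = (x ^ 2) ^ 2 by ring,
    show x ^ 8 = (x ^ 2) ^ 4 by ring, hx, neg_sq, show (-q) ^ 4 = q ^ 4 by ring] at h
  linear_combination -h - 4 * ramanujanPsi (q ^ 4) ^ 2 * hx

lemma ramanujanPhi_neg_mul_cubeRoots {q w : ℂ} (hq : ‖q‖ < 1) (hw : w ^ 2 + w + 1 = 0) :
    ramanujanPhi (-q) * ramanujanPhi (-(w * q)) * ramanujanPhi (-(w ^ 2 * q)) *
      ramanujanPhi (-q ^ 9) = ramanujanPhi (-q ^ 3) ^ 4 := by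
  have hw3 := cubeRoot_pow_three hw
  have hwn := norm_cubeRoot hw
  have hq2 := norm_pow_lt_one hq two_ne_zero
  have h1 := qPochhammerInf_self_mul_cubeRoots hq hw
  have h2 := qPochhammerInf_self_mul_cubeRoots hq2 hw
  have e1 : (w * q) ^ 2 = w ^ 2 * q ^ 2 := by ring
  have e2 : (w ^ 2 * q) ^ 2 = w * q ^ 2 := by linear_combination w * q ^ 2 * hw3
  have n0 := qPochhammerInf_self_ne_zero hq2
  have n1 := qPochhammerInf_self_ne_zero (q := w * q ^ 2) (by simpa [hwn] using hq)
  have n2 := qPochhammerInf_self_ne_zero (q := w ^ 2 * q ^ 2) (by simpa [hwn] using hq)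
  have n3 := qPochhammerInf_self_ne_zero (norm_pow_lt_one hq2 (by norm_num : 9 ≠ 0))
  have n4 := qPochhammerInf_self_ne_zero (norm_pow_lt_one hq2 three_ne_zero)
  simp only [ramanujanPhi_neg, e1, e2]
  rw [pow_right_comm q 9 2, pow_right_comm q 3 2, div_pow,
    pow_right_comm (qPochhammerInf _ _) 2 4, ← h1, ← h2]
  field_simp

/-! ### Multisection of power series -/

lemma exists_pow_eq_of_norm_lt_one {q : ℂ} (hq : ‖q‖ < 1) (hq0 : q ≠ 0) {m : ℕ} (hm : 0 < m) :
    ∃ x : ℂ, x ^ m = q ∧ x ≠ 0 ∧ ‖x‖ < 1 := by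
  obtain ⟨x, hx⟩ := IsAlgClosed.exists_pow_nat_eq q hm
  refine ⟨x, hx, ?_, ?_⟩
  · rintro rfl
    exact hq0 (by simpa [hm.ne'] using hx.symm)
  · rw [← pow_lt_one_iff_of_nonneg (norm_nonneg x) hm.ne', ← norm_pow, hx]
    exact hq

/-- If `g` has the sum `x ^ r * s`, agrees with the terms `c n * x ^ n` on the residue class of `r`
modulo `m`, and vanishes off it, then the subseries of the `c (m * n + r)`, taken at `x ^ m`, has
the sum `s`. -/
lemma hasSum_of_residue {c g : ℕ → ℂ} {x s : ℂ} {m r : ℕ} (hm : 0 < m) (hx : x ≠ 0)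
    (h : HasSum g (x ^ r * s)) (hin : ∀ n, g (m * n + r) = c (m * n + r) * x ^ (m * n + r))
    (hout : ∀ n, n % m ≠ r → g n = 0) :
    HasSum (fun n => c (m * n + r) * (x ^ m) ^ n) s := by
  have hinj : Function.Injective fun n : ℕ => m * n + r :=
    fun a b hab => Nat.eq_of_mul_eq_mul_left hm (Nat.add_right_cancel hab)
  rw [← hinj.hasSum_iff] at h
  · have hxr : x ^ r ≠ 0 := pow_ne_zero r hx
    convert! h.mul_left (x ^ r)⁻¹ using 1
    · funext n
      rw [Function.comp_apply, hin, pow_add, pow_mul]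
      field_simp
    · field_simp
  · intro n hn
    refine hout n fun h => hn ⟨n / m, ?_⟩
    simp only [← h, Nat.div_add_mod]

/-- Extraction of the odd coefficients. -/
lemma hasSum_odd_coeff {c : ℕ → ℂ} {F G : ℂ → ℂ}
    (hF : ∀ x : ℂ, ‖x‖ < 1 → x ≠ 0 → HasSum (fun n => c n * x ^ n) (F x))
    (hG : ∀ x : ℂ, ‖x‖ < 1 → x ≠ 0 → F x - F (-x) = 2 * x * G (x ^ 2))
    {q : ℂ} (hq : ‖q‖ < 1) (hq0 : q ≠ 0) :
    HasSum (fun n => c (2 * n + 1) * q ^ n) (G q) := by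
  obtain ⟨x, rfl, hx0, hx⟩ := exists_pow_eq_of_norm_lt_one hq hq0 two_pos
  have h := ((hF x hx hx0).sub (hF (-x) (by simpa using hx) (neg_ne_zero.2 hx0))).mul_left (1 / 2)
  rw [hG x hx hx0, show 1 / 2 * (2 * x * G (x ^ 2)) = x ^ 1 * G (x ^ 2) by ring] at h
  refine hasSum_of_residue two_pos hx0 h (fun n => ?_) fun n hn => ?_
  · rw [(odd_two_mul_add_one n).neg_pow]
    ring
  · rw [(Nat.even_iff.2 (by omega)).neg_pow]
    ring

/-- Extraction of the coefficients whose index is `2` modulo `3`. -/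
lemma hasSum_three_mul_add_two_coeff {c : ℕ → ℂ} {F G : ℂ → ℂ} {w : ℂ} (hw : w ^ 2 + w + 1 = 0)
    (hF : ∀ x : ℂ, ‖x‖ < 1 → x ≠ 0 → HasSum (fun n => c n * x ^ n) (F x))
    (hG : ∀ x : ℂ, ‖x‖ < 1 → x ≠ 0 →
      F x + w * F (w * x) + w ^ 2 * F (w ^ 2 * x) = 3 * x ^ 2 * G (x ^ 3))
    {q : ℂ} (hq : ‖q‖ < 1) (hq0 : q ≠ 0) :
    HasSum (fun n => c (3 * n + 2) * q ^ n) (G q) := by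
  have hw3 := cubeRoot_pow_three hw
  have hwn := norm_cubeRoot hw
  have hw0 : w ≠ 0 := by
    rw [← norm_pos_iff, hwn]
    exact one_pos
  obtain ⟨x, rfl, hx0, hx⟩ := exists_pow_eq_of_norm_lt_one hq hq0 three_pos
  have h := (((hF x hx hx0).add ((hF (w * x) (by simpa [hwn] using hx)
    (mul_ne_zero hw0 hx0)).mul_left w)).add ((hF (w ^ 2 * x) (by simpa [hwn] using hx)
    (mul_ne_zero (pow_ne_zero 2 hw0) hx0)).mul_left (w ^ 2))).mul_left (1 / 3)
  rw [hG x hx hx0, show 1 / 3 * (3 * x ^ 2 * G (x ^ 3)) = x ^ 2 * G (x ^ 3) by ring] at h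
  have hmod (k r : ℕ) : w ^ (3 * k + r) = w ^ r := by rw [pow_add, pow_mul, hw3, one_pow, one_mul]
  refine hasSum_of_residue three_pos hx0 h (fun n => ?_) fun n hn => ?_
  · rw [mul_pow, mul_pow, ← pow_mul, mul_comm 2, pow_mul, hmod]
    linear_combination
      (c (3 * n + 2) * x ^ (3 * n + 2) / 3) * (2 + w ^ 3) * hw3
  · rw [mul_pow, mul_pow, ← pow_mul, mul_comm 2, pow_mul]
    have : n % 3 = 0 ∨ n % 3 = 1 := by omega
    rcases this with h' | h' <;> rw [← Nat.div_add_mod n 3, hmod, h']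
    · linear_combination (c (3 * (n / 3) + 0) * x ^ (3 * (n / 3) + 0) / 3) * hw
    · linear_combination (c (3 * (n / 3) + 1) * x ^ (3 * (n / 3) + 1) / 3) * (hw + w * hw3)

/-- The value of a power series at the origin is determined by continuity. -/
lemma hasSum_of_hasSum_ne_zero {c : ℕ → ℂ} {G : ℂ → ℂ}
    (h : ∀ q : ℂ, ‖q‖ < 1 → q ≠ 0 → HasSum (fun n => c n * q ^ n) (G q))
    (hG : ContinuousAt G 0) {q : ℂ} (hq : ‖q‖ < 1) :
    HasSum (fun n => c n * q ^ n) (G q) := by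
  rcases ne_or_eq q 0 with hq0 | rfl
  · exact h q hq hq0
  have h0 := hasSum_single (f := fun n => c n * (0 : ℂ) ^ n) 0 fun n hn => by simp [hn]
  suffices hc0 : G 0 = c 0 * 0 ^ 0 by rwa [hc0]
  have hs : Summable fun n => ‖c n * (1 / 2 : ℂ) ^ n‖ :=
    (h (1 / 2) (by norm_num) (by norm_num)).summable.norm
  have hc : ContinuousOn (fun q : ℂ => ∑' n, c n * q ^ n) (Metric.closedBall 0 (1 / 2)) := by
    refine continuousOn_tsum (fun n => by fun_prop) hs fun n x hx => ?_
    rw [mem_closedBall_zero_iff] at hx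
    rw [norm_mul, norm_mul, norm_pow, norm_pow]
    gcongr
    simpa using hx
  have hc0 := hc.continuousAt (Metric.closedBall_mem_nhds (0 : ℂ) (by norm_num))
  rw [← h0.tsum_eq]
  refine tendsto_nhds_unique (hG.mono_left nhdsWithin_le_nhds : Tendsto G (𝓝[≠] 0) _)
    (Tendsto.congr' ?_ (hc0.mono_left nhdsWithin_le_nhds :
      Tendsto (fun q : ℂ => ∑' n, c n * q ^ n) (𝓝[≠] 0) _))
  filter_upwards [self_mem_nhdsWithin,
    mem_nhdsWithin_of_mem_nhds (Metric.ball_mem_nhds (0 : ℂ) one_pos)] with x hx0 hx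
  exact (h x (by simpa using hx) hx0).tsum_eq

/-! ### Overpartition pairs in residue classes -/

/-- The generating function of overpartition pairs is `1 / φ(-q) ^ 2`. -/
lemma hasSum_overpartitionPairCount_phi {q : ℂ} (hq : ‖q‖ < 1) :
    HasSum (fun n => (overpartitionPairCount n : ℂ) * q ^ n) (1 / ramanujanPhi (-q) ^ 2) := by
  convert! hasSum_overpartitionPairCount hq using 1
  rw [ramanujanPhi_neg]
  have h1 := qPochhammerInf_self_ne_zero hq
  have h2 := qPochhammerInf_self_ne_zero (norm_pow_lt_one hq two_ne_zero)
  field_simp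

/-- The rational identity extracting the terms `q ^ (3 * n + 2)` of `1 / (a - 2 * b) ^ 2`, where
`a` and `b` collect the exponents divisible by `3` and those that are `1` modulo `3`. -/
lemma sum_cubeRoots_one_div_sq {a b w p₀ p₁ p₂ : ℂ} (hw : w ^ 2 + w + 1 = 0)
    (h₀ : p₀ ≠ 0) (h₁ : p₁ ≠ 0) (h₂ : p₂ ≠ 0) (e₀ : p₀ = a - 2 * b) (e₁ : p₁ = a - 2 * (w * b))
    (e₂ : p₂ = a - 2 * (w ^ 2 * b)) :
    1 / p₀ ^ 2 + w * (1 / p₁ ^ 2) + w ^ 2 * (1 / p₂ ^ 2) =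
      36 * a ^ 4 * b ^ 2 / (p₀ * p₁ * p₂ * a) ^ 2 := by
  have hw3 := cubeRoot_pow_three hw
  have f₀ : p₁ * p₂ = a ^ 2 + 2 * a * b + 4 * b ^ 2 := by
    rw [e₁, e₂]
    linear_combination -2 * a * b * hw + 4 * b ^ 2 * hw3
  have f₁ : p₀ * p₂ = a ^ 2 + 2 * w * a * b + 4 * w ^ 2 * b ^ 2 := by
    rw [e₀, e₂]
    linear_combination -2 * a * b * hw
  have f₂ : p₀ * p₁ = a ^ 2 + 2 * w ^ 2 * a * b + 4 * w * b ^ 2 := by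
    rw [e₀, e₁]
    linear_combination -2 * a * b * hw
  have key : (p₁ * p₂) ^ 2 + w * (p₀ * p₂) ^ 2 + w ^ 2 * (p₀ * p₁) ^ 2 = 36 * a ^ 2 * b ^ 2 := by
    rw [f₀, f₁, f₂]
    linear_combination (a ^ 4 + 4 * a ^ 3 * b * (w ^ 2 - w + 1) + 16 * (a * b ^ 3 + b ^ 4)) * hw +
      (a ^ 2 * b ^ 2 * (4 * w ^ 3 + 24) + 16 * (a * b ^ 3 + b ^ 4) * (w + w ^ 2)) * hw3
  field_simp
  linear_combination key

lemma hasSum_three_mul_add_two_phi {q : ℂ} (hq : ‖q‖ < 1) (hq0 : q ≠ 0) :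
    HasSum (fun n => (overpartitionPairCount (3 * n + 2) : ℂ) * q ^ n)
      (12 * ramanujanPhi (-q ^ 3) ^ 4 * ramanujanOmega q ^ 2 / ramanujanPhi (-q) ^ 8) := by
  obtain ⟨w, hw⟩ : ∃ w : ℂ, w ^ 2 + w + 1 = 0 := by
    obtain ⟨s, hs⟩ := IsAlgClosed.exists_pow_nat_eq (-3 : ℂ) two_pos
    exact ⟨(s - 1) / 2, by linear_combination hs / 4⟩
  have hw3 := cubeRoot_pow_three hw
  have hwn := norm_cubeRoot hw
  have hw0 : w ≠ 0 := by
    rw [← norm_pos_iff, hwn]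
    exact one_pos
  refine hasSum_three_mul_add_two_coeff (c := fun n => (overpartitionPairCount n : ℂ))
    (F := fun x => 1 / ramanujanPhi (-x) ^ 2)
    (G := fun q => 12 * ramanujanPhi (-q ^ 3) ^ 4 * ramanujanOmega q ^ 2 / ramanujanPhi (-q) ^ 8)
    hw (fun x hx _ => hasSum_overpartitionPairCount_phi hx) (fun x hx hx0 => ?_) hq hq0
  have hx1 : ‖w * x‖ < 1 := by simpa [hwn] using hx
  have hx2 : ‖w ^ 2 * x‖ < 1 := by simpa [hwn] using hx
  have d0 := ramanujanPhi_neg_eq_three hx hx0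
  have d1 := ramanujanPhi_neg_eq_three hx1 (mul_ne_zero hw0 hx0)
  have d2 := ramanujanPhi_neg_eq_three hx2 (mul_ne_zero (pow_ne_zero 2 hw0) hx0)
  have hD := ramanujanPhi_neg_mul_cubeRoots hx hw
  have n0 := ramanujanPhi_ne_zero (q := -x) (by simpa using hx)
  have n1 := ramanujanPhi_ne_zero (q := -(w * x)) (by simpa using hx1)
  have n2 := ramanujanPhi_ne_zero (q := -(w ^ 2 * x)) (by simpa using hx2)
  have w6 : w ^ 6 = 1 := by linear_combination (w ^ 3 + 1) * hw3
  have w9 : w ^ 9 = 1 := by linear_combination (w ^ 6 + w ^ 3 + 1) * hw3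
  have w18 : w ^ 18 = 1 := by linear_combination (w ^ 9 + 1) * w9
  simp only [mul_pow, ← pow_mul, hw3, w9] at d1 d2
  norm_num [w6, w18] at d1 d2
  simp only [← pow_mul]
  norm_num
  have h := sum_cubeRoots_one_div_sq (b := x * ramanujanOmega (x ^ 3)) hw n0 n1 n2
    (by rw [d0]; ring) (by rw [d1]; ring) (by rw [d2]; ring)
  rw [hD] at h
  simp only [one_div] at h
  rw [h, show ramanujanPhi (-x ^ 3) ^ 8 = (ramanujanPhi (-x ^ 3) ^ 4) ^ 2 by ring]
  ring

lemma hasSum_odd_phi {q : ℂ} (hq : ‖q‖ < 1) (hq0 : q ≠ 0) :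
    HasSum (fun n => (overpartitionPairCount (2 * n + 1) : ℂ) * q ^ n)
      (4 * ramanujanPsi (q ^ 2) ^ 2 * ramanujanPhi q ^ 4 / ramanujanPhi (-q ^ 2) ^ 8) := by
  refine hasSum_odd_coeff (c := fun n => (overpartitionPairCount n : ℂ))
    (F := fun x => 1 / ramanujanPhi (-x) ^ 2)
    (G := fun q => 4 * ramanujanPsi (q ^ 2) ^ 2 * ramanujanPhi q ^ 4 / ramanujanPhi (-q ^ 2) ^ 8)
    (fun x hx _ => hasSum_overpartitionPairCount_phi hx) (fun x hx hx0 => ?_) hq hq0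
  have hx2 := norm_pow_lt_one hx two_ne_zero
  have s1 := ramanujanPhi_sq hx hx0
  have s2 := ramanujanPhi_sq (q := -x) (by simpa using hx) (neg_ne_zero.2 hx0)
  have m1 := ramanujanPhi_mul_neg hx
  have m2 := ramanujanPhi_mul_neg hx2
  have n0 := ramanujanPhi_ne_zero hx
  have n1 := ramanujanPhi_ne_zero (q := -x) (by simpa using hx)
  have n2 := ramanujanPhi_ne_zero hx2
  rw [neg_sq, show (-x) ^ 4 = x ^ 4 by ring] at s2
  simp only [← pow_mul] at m2 ⊢
  norm_num at m2 ⊢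
  -- Hence `1 / φ(-x) ^ 2 = φ(x) ^ 2 * φ(x ^ 2) ^ 4 / φ(-x ^ 4) ^ 8`, where only the factor
  -- `φ(x) ^ 2` is not even.
  have e : ramanujanPhi (-x ^ 4) ^ 8 =
      (ramanujanPhi (x ^ 2) ^ 2 * (ramanujanPhi x * ramanujanPhi (-x))) ^ 2 := by
    rw [m1]
    linear_combination (-(ramanujanPhi (x ^ 2) * ramanujanPhi (-x ^ 2)) ^ 3 -
      (ramanujanPhi (x ^ 2) * ramanujanPhi (-x ^ 2)) ^ 2 * ramanujanPhi (-x ^ 4) ^ 2 -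
      (ramanujanPhi (x ^ 2) * ramanujanPhi (-x ^ 2)) * ramanujanPhi (-x ^ 4) ^ 4 -
      ramanujanPhi (-x ^ 4) ^ 6) * m2
  rw [e]
  field_simp
  linear_combination s1 - s2

lemma hasSum_four_mul_add_three_phi {q : ℂ} (hq : ‖q‖ < 1) (hq0 : q ≠ 0) :
    HasSum (fun n => (overpartitionPairCount (4 * n + 3) : ℂ) * q ^ n)
      (32 * ramanujanPsi q ^ 6 / ramanujanPhi (-q) ^ 8) := by
  have h := hasSum_odd_coeff (c := fun n => (overpartitionPairCount (2 * n + 1) : ℂ))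
    (F := fun q => 4 * ramanujanPsi (q ^ 2) ^ 2 * ramanujanPhi q ^ 4 / ramanujanPhi (-q ^ 2) ^ 8)
    (G := fun q => 32 * ramanujanPsi q ^ 6 / ramanujanPhi (-q) ^ 8)
    (fun x hx hx0 => hasSum_odd_phi hx hx0) (fun x hx hx0 => ?_) hq hq0
  · simpa only [show ∀ n, 2 * (2 * n + 1) + 1 = 4 * n + 3 from fun n => by ring] using h
  have hx2 := norm_pow_lt_one hx two_ne_zero
  have s1 := ramanujanPhi_sq hx hx0
  have s2 := ramanujanPhi_sq (q := -x) (by simpa using hx) (neg_ne_zero.2 hx0)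
  have m := ramanujanPhi_mul_ramanujanPsi_sq hx2
  rw [neg_sq, show (-x) ^ 4 = x ^ 4 by ring] at s2
  rw [← pow_mul] at m
  norm_num at m
  simp only [neg_sq]
  rw [div_sub_div_same, ← mul_div_assoc]
  congr 1
  rw [show ramanujanPhi x ^ 4 = (ramanujanPhi x ^ 2) ^ 2 by ring,
    show ramanujanPhi (-x) ^ 4 = (ramanujanPhi (-x) ^ 2) ^ 2 by ring, s1, s2,
    show ramanujanPsi (x ^ 2) ^ 6 = ramanujanPsi (x ^ 2) ^ 2 * (ramanujanPsi (x ^ 2) ^ 2) ^ 2 by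
      ring, ← m]
  ring

theorem mainTheorem1 (q : ℂ) (hq : ‖q‖ < 1) :
    HasSum (fun n : ℕ => (overpartitionPairCount (3 * n + 2) : ℂ) * q ^ n)
      (12 * (qPochhammerInf (q ^ 2) (q ^ 2) ^ 6 * qPochhammerInf (q ^ 3) (q ^ 3) ^ 6 /
        qPochhammerInf q q ^ 14)) ∧
    HasSum (fun n : ℕ => (overpartitionPairCount (4 * n + 3) : ℂ) * q ^ n)
      (32 * (qPochhammerInf (q ^ 2) (q ^ 2) ^ 20 / qPochhammerInf q q ^ 22)) := by
  have c1 := continuousAt_qPochhammerInf_self_zero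
  have c2 := continuousAt_qPochhammerInf_pow_zero two_ne_zero
  have c3 := continuousAt_qPochhammerInf_pow_zero three_ne_zero
  have hn : qPochhammerInf 0 0 ≠ 0 := qPochhammerInf_self_ne_zero (by simp)
  constructor
  · refine hasSum_of_hasSum_ne_zero (c := fun n => (overpartitionPairCount (3 * n + 2) : ℂ))
      (G := fun q => 12 * (qPochhammerInf (q ^ 2) (q ^ 2) ^ 6 * qPochhammerInf (q ^ 3) (q ^ 3) ^ 6 /
        qPochhammerInf q q ^ 14)) (fun q hq hq0 => ?_)
      ((((c2.pow 6).mul (c3.pow 6)).div (c1.pow 14) (pow_ne_zero 14 hn)).const_mul 12) hq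
    convert! hasSum_three_mul_add_two_phi hq hq0 using 1
    have h1 := qPochhammerInf_self_ne_zero hq
    have h2 := qPochhammerInf_self_ne_zero (norm_pow_lt_one hq two_ne_zero)
    have h3 := qPochhammerInf_self_ne_zero (norm_pow_lt_one hq three_ne_zero)
    have h6 := qPochhammerInf_self_ne_zero (norm_pow_lt_one hq (by norm_num : 6 ≠ 0))
    rw [ramanujanPhi_neg, ramanujanPhi_neg, ramanujanOmega, ← pow_mul]
    norm_num
    field_simp
  · refine hasSum_of_hasSum_ne_zero (c := fun n => (overpartitionPairCount (4 * n + 3) : ℂ))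
      (G := fun q => 32 * (qPochhammerInf (q ^ 2) (q ^ 2) ^ 20 / qPochhammerInf q q ^ 22))
      (fun q hq hq0 => ?_)
      (((c2.pow 20).div (c1.pow 22) (pow_ne_zero 22 hn)).const_mul 32) hq
    convert! hasSum_four_mul_add_three_phi hq hq0 using 1
    have h1 := qPochhammerInf_self_ne_zero hq
    have h2 := qPochhammerInf_self_ne_zero (norm_pow_lt_one hq two_ne_zero)
    rw [ramanujanPhi_neg, ramanujanPsi]
    field_simp
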